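/- Let $\mathcal A$ be a unital associative algebra over $\mathbb C$. The \emph{noncommutative tensor spreadability system} for $(\mathcal A,\mathrm{Id})$ consists of the algebraic infinite tensor product $\mathcal U=\bigotimes_{j\ge 1}\mathcal A$ (the direct limit of the tensor powers $\mathcal A^{\otimes N}$ along $t\mapsto t\otimes 1$), the embeddings $X\mapsto X^{(j)}$ of $\mathcal A$ into the $j$-th tensor component, and the expectation $\widetilde\varphi:\mathcal U\to\mathcal A$ given by the concatenation product $X_1\otimes X_2\otimes\cdots\mapsto X_1X_2\cdots$. Write $N.X=X^{(1)}+\cdots+X^{(N)}$. (i) For all $n\ge 0$ and $X_1,\dots,X_n\in\mathcal A$ there is a unique polynomial $P$ with coefficients in $\mathcal A$ such that $P(N)=\widetilde\varphi\big((N.X_1)(N.X_2)\cdots(N.X_n)\big)$ for every integer $N\ge 1$. The $n$-th \emph{NCT cumulant} $K_n^{\mathrm{NCT}}(X_1,\dots,X_n)$ is defined as the coefficient of $N$ in this polynomial. (ii) For $n\ge 1$, $$K_n^{\mathrm{NCT}}(X_1,\dots,X_n)=\sum_{\pi=(P_1,\dots,P_{|\pi|})\in\mathcal{OP}_n}\frac{(-1)^{|\pi|-1}}{|\pi|}\,X_{P_1}X_{P_2}\cdots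 X_{P_{|\pi|}},$$ where $\mathcal{OP}_n$ is the set of ordered set partitions of $[n]$ (sequences of nonempty pairwise disjoint blocks with union $[n]$) and $X_P=X_{p_1}\cdots X_{p_k}$ for $P=\{p_1<\dots<p_k\}$. (iii) (CBH formula) For all $n\ge 0$ and $a_1,\dots,a_n\in\mathcal A$, $$\log\big(e^{z_1a_1}e^{z_2a_2}\cdots e^{z_na_n}\big)=\sum_{\substack{p\in\mathbb{Z}_{\ge0}^n\\ p\ne 0}}\frac{z_1^{p_1}\cdots z_n^{p_n}}{p_1!\cdots p_n!}\,K^{\mathrm{NCT}}_{p_1+\cdots+p_n}(\underbrace{a_1,\dots,a_1}_{p_1},\dots,\underbrace{a_n,\dots,a_n}_{p_n})$$ as an identity of formal power series over $\mathcal A$ in commuting indeterminates $z_1,\dots,z_n$ that commute with $\mathcal A$; here $e^g=\sum_{k\ge0}g^k/k!$ and $\log f=\sum_{k\ge1}\frac{(-1)^{k-1}}{k}(f-1)^k$. (iv) Let $\mathfrak A$ be an alphabet and $\mathbb C[\mathfrak A]$ the monoid algebra of the free monoid $\mathfrak A^*$; write $K_n^{\mathrm{FL}}$ for $K_n^{\mathrm{NCT}}$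 when $\mathcal A=\mathbb C[\mathfrak A]$. Let $\delta_k:\mathbb C[\mathfrak A]\to\mathbb C[\mathfrak A]^{\otimes k}$ be the algebra homomorphism with $\delta_k(a)=\sum_{j=0}^{k-1}1^{\otimes j}\otimes a\otimes1^{\otimes(k-j-1)}$ for $a\in\mathfrak A$, let $\epsilon$ be the counit ($\epsilon(1)=1$, $\epsilon(w)=0$ for nonempty words $w$) viewed as an endomorphism, let $f_1*\cdots*f_k=\mathrm{conc}_k\circ(f_1\otimes\cdots\otimes f_k)\circ\delta_k$ with $\mathrm{conc}_k(x_1\otimes\cdots\otimes x_k)=x_1\cdots x_k$, and let $\Pi=\sum_{k\ge1}\frac{(-1)^{k-1}}{k}(\mathrm{Id}-\epsilon)^{*k}$. Then for all $n\ge 0$ and letters $a_1,\dots,a_n\in\mathfrak A$ only finitely many terms of the sum defining $\Pi(a_1a_2\cdots a_n)$ are nonzero, and $$K_n^{\mathrm{FL}}(a_1,\dots,a_n)=\Pi(a_1a_2\cdots a_n).$$ -/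

import Mathlib

open scoped TensorProduct

noncomputable section

namespace NCT

/-! ### Spreadability systems and their cumulants -/

/-- A spreadability system for the `B`-valued noncommutative probability space `(A, φ)`:
a unital algebra `U` with a unital linear map `exp : U → B` and homomorphisms `ι j : A → U`
(not necessarily unit preserving) that reproduce `φ`, such that the joint distribution of the
copies `ι j` is invariant under order preserving changes of the indices. The copies are numbered
`0, 1, 2, …`. -/
structure SpreadabilitySystem {A B : Type*} [Ring A] [Algebra ℂ A] [Ring B] [Algebra ℂ B]
    (φ : A →ₗ[ℂ] B) (U : Type*) [Ring U] [Algebra ℂ U] where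
  exp : U →ₗ[ℂ] B
  exp_one : exp 1 = 1
  ι : ℕ → A →ₙₐ[ℂ] U
  exp_ι : ∀ (j : ℕ) (x : A), exp (ι j x) = φ x
  spreadable : ∀ (n : ℕ) (X : Fin n → A) (i : Fin n → ℕ) (h : ℕ → ℕ),
    (∀ p q, i p < i q → h (i p) < h (i q)) →
      exp (List.ofFn fun k => ι (i k) (X k)).prod =
        exp (List.ofFn fun k => ι (h (i k)) (X k)).prod

namespace SpreadabilitySystem

variable {A B : Type*} [Ring A] [Algebra ℂ A] [Ring B] [Algebra ℂ B] {φ : A →ₗ[ℂ] B}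
  {U : Type*} [Ring U] [Algebra ℂ U]

/-- The dot operation `N.X`: the sum of the first `N` copies of `X`. -/
def dot (S : SpreadabilitySystem φ U) (N : ℕ) (x : A) : U :=
  ∑ j ∈ Finset.range N, S.ι j x

/-- The expectation of `(N.X₁) (N.X₂) ⋯ (N.Xₙ)`. -/
def dotMoment (S : SpreadabilitySystem φ U) {n : ℕ} (X : Fin n → A) (N : ℕ) : B :=
  S.exp (List.ofFn fun k => S.dot N (X k)).prod

/-- The polynomial `P` with coefficients in `B` computes `N ↦ E[(N.X₁) ⋯ (N.Xₙ)]`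
at every positive integer `N`. -/
def IsDotPolynomial (S : SpreadabilitySystem φ U) {n : ℕ} (X : Fin n → A)
    (P : Polynomial B) : Prop :=
  ∀ N : ℕ, 0 < N → P.eval (N : B) = S.dotMoment X N

open Classical in
/-- The `n`-th cumulant `Kₙ(X₁, …, Xₙ)`: the coefficient of `N` in `E[(N.X₁) ⋯ (N.Xₙ)]`,
which is a polynomial in `N`. -/
def cumulant (S : SpreadabilitySystem φ U) {n : ℕ} (X : Fin n → A) : B :=
  if h : ∃ P : Polynomial B, S.IsDotPolynomial X P then h.choose.coeff 1 else 0

end SpreadabilitySystem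

/-! ### The noncommutative tensor spreadability system -/

section TensorSystem

theorem prod_map_filter {ι R : Type*} [Monoid R] (l : List ι) (p : ι → Bool) (g : ι → R)
    (hg : ∀ j ∈ l, p j = false → g j = 1) : ((l.filter p).map g).prod = (l.map g).prod := by
  induction l with
  | nil => rfl
  | cons a l ih =>
    have ih := ih fun j hj => hg j (List.mem_cons_of_mem _ hj)
    by_cases ha : p a = true
    · simp [ha, ih]
    · simp [ha, ih, hg a List.mem_cons_self (by simpa using ha)]

variable (A : Type*) [Ring A] [Algebra ℂ A]

/-- `x₁ ⊗ ⋯ ⊗ x_M ↦ x₁ ⊗ ⋯ ⊗ x_M ⊗ 1 ⊗ ⋯ ⊗ 1` as a multilinear map. -/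
def padMultilinear (M N : ℕ) (h : M ≤ N) :
    MultilinearMap ℂ (fun _ : Fin M => A) (⨂[ℂ] _ : Fin N, A) where
  toFun x := PiTensorProduct.tprod ℂ fun m : Fin N => if hm : m.1 < M then x ⟨m.1, hm⟩ else 1
  map_update_add' {_} x i a b := by
    have key : ∀ c : A, (fun m : Fin N => if hm : m.1 < M then Function.update x i c ⟨m.1, hm⟩
        else 1) = Function.update (fun m : Fin N => if hm : m.1 < M then x ⟨m.1, hm⟩ else 1)
          (Fin.castLE h i) c := by
      intro c
      ext m
      by_cases hm : m.1 < M
      · by_cases hi : m = Fin.castLE h i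
        · subst hi
          have : (⟨(Fin.castLE h i).1, hm⟩ : Fin M) = i := rfl
          simp [Function.update]
        · have : (⟨m.1, hm⟩ : Fin M) ≠ i := fun e => hi (by rw [← e]; rfl)
          simp [hm, hi, this, Function.update]
      · have hi : m ≠ Fin.castLE h i := fun e => hm (by rw [e]; exact i.2)
        simp [hm, hi, Function.update]
    have e : ‹DecidableEq (Fin M)› = instDecidableEqFin M := Subsingleton.elim _ _
    subst e
    rw [key, key, key, MultilinearMap.map_update_add]
  map_update_smul' {_} x i r a := by
    have key : ∀ c : A, (fun m : Fin N => if hm : m.1 < M then Function.update x i c ⟨m.1, hm⟩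
        else 1) = Function.update (fun m : Fin N => if hm : m.1 < M then x ⟨m.1, hm⟩ else 1)
          (Fin.castLE h i) c := by
      intro c
      ext m
      by_cases hm : m.1 < M
      · by_cases hi : m = Fin.castLE h i
        · subst hi
          have : (⟨(Fin.castLE h i).1, hm⟩ : Fin M) = i := rfl
          simp [Function.update]
        · have : (⟨m.1, hm⟩ : Fin M) ≠ i := fun e => hi (by rw [← e]; rfl)
          simp [hm, hi, this, Function.update]
      · have hi : m ≠ Fin.castLE h i := fun e => hm (by rw [e]; exact i.2)
        simp [hm, hi, Function.update]
    have e : ‹DecidableEq (Fin M)› = instDecidableEqFin M := Subsingleton.elim _ _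
    subst e
    rw [key, key, MultilinearMap.map_update_smul]

theorem padMultilinear_apply (M N : ℕ) (h : M ≤ N) (x : Fin M → A) :
    padMultilinear A M N h x =
      PiTensorProduct.tprod ℂ fun m : Fin N => if hm : m.1 < M then x ⟨m.1, hm⟩ else 1 := rfl

/-- The unital embedding `A^{⊗ M} → A^{⊗ N}`, `t ↦ t ⊗ 1 ⊗ ⋯ ⊗ 1`, for `M ≤ N`. -/
def pad (M N : ℕ) (h : M ≤ N) : (⨂[ℂ] _ : Fin M, A) →ₐ[ℂ] (⨂[ℂ] _ : Fin N, A) :=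
  PiTensorProduct.liftAlgHom (padMultilinear A M N h)
    (by
      rw [padMultilinear_apply, PiTensorProduct.one_def]
      congr 1
      ext m
      simp)
    (by
      intro x y
      simp only [padMultilinear_apply, PiTensorProduct.tprod_mul_tprod]
      congr 1
      ext m
      by_cases hm : m.1 < M <;> simp [hm])

theorem pad_tprod (M N : ℕ) (h : M ≤ N) (x : Fin M → A) :
    pad A M N h (PiTensorProduct.tprod ℂ x) =
      PiTensorProduct.tprod ℂ fun m : Fin N => if hm : m.1 < M then x ⟨m.1, hm⟩ else 1 := by
  simp [pad, padMultilinear_apply]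

instance pad_directedSystem :
    DirectedSystem (fun N : ℕ => ⨂[ℂ] _ : Fin N, A) (fun M N h => ⇑(pad A M N h)) where
  map_self M x := by
    have : (pad A M M le_rfl).toLinearMap = LinearMap.id := by
      apply PiTensorProduct.ext
      ext x
      simp [pad_tprod]
    exact LinearMap.congr_fun this x
  map_map N M L h₁ h₂ x := by
    have : (pad A M N h₂).toLinearMap ∘ₗ (pad A L M h₁).toLinearMap =
        (pad A L N (h₁.trans h₂)).toLinearMap := by
      apply PiTensorProduct.ext
      ext x
      simp only [LinearMap.compMultilinearMap_apply, LinearMap.comp_apply, AlgHom.toLinearMap_apply,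
        pad_tprod]
      congr 1
      ext m
      by_cases h1 : m.1 < L
      · simp [h1, h1.trans_le h₁]
      · simp [h1]
    exact LinearMap.congr_fun this x

/-- The algebraic infinite tensor product `A ⊗ A ⊗ ⋯` of the unital algebra `A`: the direct limit
of the finite tensor powers along `t ↦ t ⊗ 1`. -/
abbrev InfTensor : Type _ :=
  DirectLimit (fun N : ℕ => ⨂[ℂ] _ : Fin N, A) (pad A)

/-- The concatenation product `x₁ ⊗ ⋯ ⊗ x_N ↦ x₁ ⋯ x_N` on the finite tensor power. -/
def conc (N : ℕ) : (⨂[ℂ] _ : Fin N, A) →ₗ[ℂ] A :=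
  PiTensorProduct.lift (MultilinearMap.mkPiAlgebraFin ℂ N A)

theorem conc_tprod (N : ℕ) (x : Fin N → A) :
    conc A N (PiTensorProduct.tprod ℂ x) = (List.ofFn x).prod := by
  simp [conc]

theorem conc_pad (M N : ℕ) (h : M ≤ N) (t : ⨂[ℂ] _ : Fin M, A) :
    conc A N (pad A M N h t) = conc A M t := by
  have : conc A N ∘ₗ (pad A M N h).toLinearMap = conc A M := by
    apply PiTensorProduct.ext
    ext x
    simp only [LinearMap.compMultilinearMap_apply, LinearMap.comp_apply, AlgHom.toLinearMap_apply,
      pad_tprod, conc_tprod]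
    obtain ⟨k, rfl⟩ := Nat.exists_eq_add_of_le h
    rw [List.ofFn_add]
    simp
  exact LinearMap.congr_fun this t

/-- The concatenation product on the infinite tensor product. -/
def concInf : InfTensor A →ₗ[ℂ] A :=
  DirectLimit.Module.lift ℂ ℕ _ (pad A) (conc A) (fun M N h t => conc_pad A M N h t)

theorem concInf_mk (N : ℕ) (t : ⨂[ℂ] _ : Fin N, A) :
    concInf A (⟦⟨N, t⟩⟧ : InfTensor A) = conc A N t :=
  DirectLimit.Module.lift_of (R := ℂ) (ι := ℕ) (f := pad A) (conc A)
    (fun M N h t => conc_pad A M N h t) t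

/-- The embedding of `A` into the `j`-th tensor component (components numbered `0, 1, 2, …`). -/
def embed (j : ℕ) : A →ₙₐ[ℂ] InfTensor A where
  toFun x := ⟦⟨j + 1, PiTensorProduct.singleAlgHom (Fin.last j) x⟩⟧
  map_smul' r x := by
    rw [map_smul]
    exact (DirectLimit.smul_def _ _ _).symm
  map_zero' := by
    rw [map_zero]
    exact (DirectLimit.zero_def _).symm
  map_add' x y := by
    rw [map_add]
    exact (DirectLimit.add_def _ _ _).symm
  map_mul' x y := by
    rw [map_mul]
    exact (DirectLimit.mul_def _ _ _).symm

variable {A}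

theorem embed_eq (j M : ℕ) (h : j < M) (x : A) :
    embed A j x = (⟦⟨M, PiTensorProduct.tprod ℂ fun m : Fin M => if m.1 = j then x else 1⟩⟧ :
      InfTensor A) := by
  have : embed A j x = (⟦⟨M, pad A (j + 1) M h
      (PiTensorProduct.singleAlgHom (Fin.last j) x)⟩⟧ : InfTensor A) :=
    (DirectLimit.mk_apply (f := pad A) (j + 1) M _ h).symm
  rw [this, PiTensorProduct.singleAlgHom_apply, pad_tprod]
  congr 4
  ext m
  by_cases hm : m.1 = j
  · have : (⟨m.1, by omega⟩ : Fin (j + 1)) = Fin.last j := Fin.ext hm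
    have h1 : m.1 < j + 1 := by omega
    rw [dif_pos h1, if_pos hm, this]
    simp
  · by_cases h1 : m.1 < j + 1
    · have : (⟨m.1, h1⟩ : Fin (j + 1)) ≠ Fin.last j := fun e => hm (congrArg Fin.val e)
      simp [hm, h1, this]
    · simp [hm, h1]

theorem prod_embed (M : ℕ) (w : List (ℕ × A)) (hw : ∀ p ∈ w, p.1 < M) :
    (w.map fun p => embed A p.1 p.2).prod =
      (⟦⟨M, PiTensorProduct.tprod ℂ fun m : Fin M =>
        ((w.filter fun p => p.1 = m.1).map Prod.snd).prod⟩⟧ : InfTensor A) := by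
  induction w with
  | nil => exact DirectLimit.one_def M
  | cons p w ih =>
    rw [List.map_cons, List.prod_cons, ih fun q hq => hw q (List.mem_cons_of_mem _ hq),
      embed_eq p.1 M (hw p List.mem_cons_self), DirectLimit.mul_def,
      PiTensorProduct.tprod_mul_tprod]
    congr 4
    ext m
    by_cases hm : m.1 = p.1
    · simp [hm]
    · simp [hm, Ne.symm hm]

theorem concInf_prod_embed (M : ℕ) (w : List (ℕ × A)) (hw : ∀ p ∈ w, p.1 < M) :
    concInf A (w.map fun p => embed A p.1 p.2).prod =
      ((List.range M).map fun j => ((w.filter fun p => p.1 = j).map Prod.snd).prod).prod := by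
  rw [prod_embed M w hw, concInf_mk, conc_tprod, List.ofFn_eq_map, ← List.map_coe_finRange_eq_range, List.map_map]
  rfl

theorem concInf_spread (w : List (ℕ × A)) (h : ℕ → ℕ)
    (hh : ∀ p ∈ w, ∀ q ∈ w, p.1 < q.1 → h p.1 < h q.1) :
    concInf A (w.map fun p => embed A p.1 p.2).prod =
      concInf A (w.map fun p => embed A (h p.1) p.2).prod := by
  obtain ⟨M, hM⟩ : ∃ M, ∀ p ∈ w, p.1 < M := by
    refine ⟨(w.map Prod.fst).sum + 1, fun p hp => Nat.lt_succ_of_le ?_⟩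
    exact List.single_le_sum (by simp) _ (List.mem_map_of_mem hp)
  obtain ⟨M', hM'⟩ : ∃ M, ∀ p ∈ w, h p.1 < M := by
    refine ⟨(w.map fun p => h p.1).sum + 1, fun p hp => Nat.lt_succ_of_le ?_⟩
    exact List.single_le_sum (by simp) _ (List.mem_map_of_mem (f := fun p => h p.1) hp)
  have e2 : (w.map fun p => embed A (h p.1) p.2) =
      ((w.map fun p => (h p.1, p.2)).map fun p => embed A p.1 p.2) := by
    rw [List.map_map]; rfl
  have hM2 : ∀ q ∈ w.map (fun p => (h p.1, p.2)), q.1 < M' := by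
    intro q hq
    obtain ⟨p, hp, rfl⟩ := List.mem_map.1 hq
    exact hM' p hp
  rw [e2, concInf_prod_embed M w hM, concInf_prod_embed M' _ hM2]
  have inj : ∀ p ∈ w, ∀ q ∈ w, h p.1 = h q.1 → p.1 = q.1 := by
    intro p hp q hq e
    rcases lt_trichotomy p.1 q.1 with hlt | he | hgt
    · exact absurd e (hh p hp q hq hlt).ne
    · exact he
    · exact absurd e (hh q hq p hp hgt).ne'
  set L := (List.range M).filter fun j => decide (j ∈ w.map Prod.fst) with hL
  set L' := (List.range M').filter fun j => decide (j ∈ w.map fun p => h p.1) with hL'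
  rw [← prod_map_filter (List.range M) (fun j => decide (j ∈ w.map Prod.fst)),
    ← prod_map_filter (List.range M') (fun j => decide (j ∈ w.map fun p => h p.1)), ← hL, ← hL']
  · have memL : ∀ j, j ∈ L ↔ ∃ p ∈ w, p.1 = j := by
      intro j
      simp only [hL, List.mem_filter, List.mem_range, List.mem_map, decide_eq_true_eq]
      constructor
      · exact fun H => H.2
      · rintro ⟨p, hp, rfl⟩
        exact ⟨hM p hp, p, hp, rfl⟩
    have memL' : ∀ j, j ∈ L' ↔ ∃ p ∈ w, h p.1 = j := by
      intro j
      simp only [hL', List.mem_filter, List.mem_range, List.mem_map, decide_eq_true_eq]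
      constructor
      · exact fun H => H.2
      · rintro ⟨p, hp, rfl⟩
        exact ⟨hM' p hp, p, hp, rfl⟩
    have sL : L.Pairwise (· < ·) := List.pairwise_lt_range.filter _
    have sL' : L'.Pairwise (· < ·) := List.pairwise_lt_range.filter _
    have sLh : (L.map h).Pairwise (· < ·) := by
      rw [List.pairwise_map]
      refine sL.imp_of_mem ?_
      intro a b ha hb hab
      obtain ⟨p, hp, rfl⟩ := (memL a).1 ha
      obtain ⟨q, hq, rfl⟩ := (memL b).1 hb
      exact hh p hp q hq hab
    have eL : L' = L.map h := by
      have perm : L'.Perm (L.map h) := by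
        rw [List.perm_ext_iff_of_nodup (sL'.imp fun h => h.ne) (sLh.imp fun h => h.ne)]
        intro j
        rw [memL', List.mem_map]
        constructor
        · rintro ⟨p, hp, rfl⟩
          exact ⟨p.1, (memL _).2 ⟨p, hp, rfl⟩, rfl⟩
        · rintro ⟨a, ha, rfl⟩
          obtain ⟨p, hp, rfl⟩ := (memL a).1 ha
          exact ⟨p, hp, rfl⟩
      exact perm.eq_of_pairwise (fun a b _ _ h1 h2 => absurd h2 h1.asymm) sL' sLh
    rw [eL, List.map_map]
    congr 1
    apply List.map_congr_left
    intro j hj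
    obtain ⟨p, hp, rfl⟩ := (memL j).1 hj
    simp only [Function.comp_apply, List.filter_map, List.map_map]
    congr 1
    have : (w.filter fun q => decide (q.1 = p.1)) =
        w.filter ((fun q : ℕ × A => decide (q.1 = h p.1)) ∘ fun q => (h q.1, q.2)) := by
      apply List.filter_congr
      intro q hq
      simp only [Function.comp_apply, decide_eq_decide]
      exact ⟨fun e => by rw [e], fun e => inj q hq p hp e⟩
    rw [this]
    rfl
  · intro j _ hj
    rw [List.filter_eq_nil_iff.2]
    · rfl
    · intro q hq e
      obtain ⟨p, hp, rfl⟩ := List.mem_map.1 hq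
      exact of_decide_eq_false hj (List.mem_map.2 ⟨p, hp, of_decide_eq_true e⟩)
  · intro j _ hj
    rw [List.filter_eq_nil_iff.2]
    · rfl
    · intro q hq e
      exact of_decide_eq_false hj (List.mem_map.2 ⟨q, hq, of_decide_eq_true e⟩)

variable (A)

/-- The noncommutative tensor spreadability system for `(A, Id)`. -/
def system : SpreadabilitySystem (LinearMap.id : A →ₗ[ℂ] A) (InfTensor A) where
  exp := concInf A
  exp_one := by
    have := concInf_prod_embed (A := A) 0 [] (by simp)
    simpa using this
  ι := embed A
  exp_ι j x := by
    change concInf A (⟦⟨j + 1, PiTensorProduct.singleAlgHom (Fin.last j) x⟩⟧ : InfTensor A) = x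
    rw [concInf_mk, PiTensorProduct.singleAlgHom_apply, conc_tprod, List.ofFn_succ', List.concat_eq_append]
    have : ∀ i : Fin j, (MonoidHom.mulSingle (fun _ : Fin (j + 1) => A) (Fin.last j) x)
        i.castSucc = 1 := by
      intro i
      simp
    simp [this]
  spreadable n X i h hh := by
    have e := concInf_spread (List.ofFn fun k => (i k, X k)) h (by
      intro p hp q hq
      obtain ⟨a, rfl⟩ := (List.mem_ofFn' _ _).1 hp
      obtain ⟨b, rfl⟩ := (List.mem_ofFn' _ _).1 hq
      exact hh a b)
    simpa [List.map_ofFn, Function.comp_def] using e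

/-- The `n`-th cumulant of the noncommutative tensor spreadability system. -/
def K {n : ℕ} (X : Fin n → A) : A := (system A).cumulant X

end TensorSystem

/-! ### Ordered set partitions -/

/-- Ordered set partitions `(P₁, …, Pₚ)` of `[n]`: sequences of nonempty pairwise disjoint
blocks that cover `[n]`. -/
def OP (n : ℕ) : Type :=
  {π : List (Finset (Fin n)) //
    (∀ P ∈ π, P.Nonempty) ∧ π.Pairwise Disjoint ∧ ∀ k, ∃ P ∈ π, k ∈ P}

instance (n : ℕ) : Finite (OP n) := by
  have nodup : ∀ π : OP n, π.1.Nodup := fun π => by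
    refine π.2.2.1.imp_of_mem ?_
    intro P Q hP _ hd e
    subst e
    exact (π.2.1 P hP).ne_empty (disjoint_self.1 hd)
  exact Finite.of_injective
    (fun π : OP n => (⟨π.1, nodup π⟩ : {l : List (Finset (Fin n)) // l.Nodup}))
    fun a b e => Subtype.ext (by simpa using e)

instance (n : ℕ) : Fintype (OP n) := Fintype.ofFinite _

/-- `X_P = X_{p₁} ⋯ X_{p_k}` for `P = {p₁ < ⋯ < p_k}`. -/
def blockProd {A : Type*} [Monoid A] {n : ℕ} (X : Fin n → A) (P : Finset (Fin n)) : A :=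
  ((P.sort (· ≤ ·)).map X).prod

/-! ### Exponential and logarithm of formal power series -/

section Series

variable {σ A : Type*} [Ring A] [Algebra ℂ A]

/-- `exp g = ∑_{k ≥ 0} g^k / k!` for a power series `g` without constant term, in commuting
indeterminates that also commute with the coefficients. -/
def expSeries (g : MvPowerSeries σ A) : MvPowerSeries σ A :=
  fun d => ∑ᶠ k : ℕ, ((k.factorial : ℂ)⁻¹) • MvPowerSeries.coeff d (g ^ k)

/-- `log f = ∑_{k ≥ 1} (-1)^{k-1} (f - 1)^k / k` for a power series `f` with constant term `1`. -/
def logSeries (f : MvPowerSeries σ A) : MvPowerSeries σ A :=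
  fun d => ∑ᶠ k : ℕ, ((-1 : ℂ) ^ k / (k + 1)) • MvPowerSeries.coeff d ((f - 1) ^ (k + 1))

/-- The sequence `a₁, …, a₁, …, aₙ, …, aₙ` in which `aᵢ` is repeated `pᵢ` times. -/
def repeated {n : ℕ} (a : Fin n → A) (p : Fin n →₀ ℕ) : List A :=
  (List.finRange n).flatMap fun i => List.replicate (p i) (a i)

end Series

/-! ### The free algebra and the Lie projector -/

section Free

variable (L : Type*)

/-- The monoid algebra over `ℂ` of the free monoid of words in the alphabet `L`. -/
abbrev FreeAlg : Type _ := MonoidAlgebra ℂ (FreeMonoid L)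

variable {L}

/-- A letter, as an element of the free algebra. -/
def letter (a : L) : FreeAlg L := MonoidAlgebra.of ℂ (FreeMonoid L) (FreeMonoid.of a)

variable (L)

/-- The `k`-fold coproduct for which every letter is primitive. -/
def coprod (k : ℕ) : FreeAlg L →ₐ[ℂ] ⨂[ℂ] _ : Fin k, FreeAlg L :=
  MonoidAlgebra.lift ℂ _ (FreeMonoid L)
    (FreeMonoid.lift fun a => ∑ j : Fin k, PiTensorProduct.singleAlgHom j (letter a))

/-- The counit, as an endomorphism: `1 ↦ 1` and `w ↦ 0` for every nonempty word `w`. -/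
def counit : FreeAlg L →ₗ[ℂ] FreeAlg L :=
  Algebra.linearMap ℂ (FreeAlg L) ∘ₗ
    (MonoidAlgebra.lift ℂ ℂ (FreeMonoid L) (FreeMonoid.lift fun _ => 0)).toLinearMap

variable {L}

/-- The convolution product `f₁ * ⋯ * f_k` of endomorphisms of the free algebra. -/
def convolution {k : ℕ} (f : Fin k → (FreeAlg L →ₗ[ℂ] FreeAlg L)) :
    FreeAlg L →ₗ[ℂ] FreeAlg L :=
  conc (FreeAlg L) k ∘ₗ PiTensorProduct.map f ∘ₗ (coprod L k).toLinearMap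

/-- The `k`-th term `(-1)^{k-1}/k (Id - ε)^{*k} x`, with `k` shifted by one. -/
def lieTerm (x : FreeAlg L) (k : ℕ) : FreeAlg L :=
  ((-1 : ℂ) ^ k / (k + 1)) • convolution (fun _ : Fin (k + 1) => LinearMap.id - counit L) x

/-- `Π = ∑_{k ≥ 1} (-1)^{k-1}/k (Id - ε)^{*k}`, a pointwise finite sum. -/
def lieProj (x : FreeAlg L) : FreeAlg L := ∑ᶠ k : ℕ, lieTerm x k

end Free

end NCT

end

/-! Everything is governed by one noncommutative object: the convolution powers `convPow φ k` of a
function `φ` on words, where a word is distributed over `k` ordered slots, keeping the order within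
each slot, and the values of `φ` on the slots are multiplied. Expanding (N.X₁)⋯(N.Xₙ) in the N-th
tensor power and concatenating puts each factor into one of N slots, so the moment is the N-th
convolution power of the ordered product (`system_dotMoment_eq`).

The ordered product is the convolution unit (1 on the empty word, 0 elsewhere) plus `prodNonempty`.
The binomial theorem then gives ∑ₖ C(N,k) · `convPow prodNonempty k` (`convPow_prod_eq_sum`), and
the sum stops at the length of the word because k nonempty slots need k letters. This is a
polynomial in N; it is unique because linear functionals reduce the question to complex polynomials.
As C(N,k) has linear coefficient (-1)^(k-1)/k, the cumulant is the convolution logarithm of the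
ordered product (`K_eq_sum`).

The three formulas are three readings of `convPow prodNonempty k`. On distinct positions it sums
over ordered partitions into k blocks (`convPow_prodNonempty_sort`). On a word with repetitions,
divided by the factorials of the multiplicities, it is a coefficient of (e^{z₁a₁}⋯e^{zₙaₙ} - 1)^k
(`coeff_prod_expSeries_sub_one_pow`). On letters of the free algebra it is (Id - ε)^{*k}
(`convolution_prod_letter`). -/

noncomputable section

namespace NCT

/-! ### Unshuffling a list into two sublists -/

section Unshuffle

variable {α β M : Type*} [AddCommMonoid M]

/-- The sum of `F u v` over all ways of distributing the entries of a list to two lists `u` and `v`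
with the order kept in each of them. -/
def unshuffleSum : (List α → List α → M) → List α → M
  | F, [] => F [] []
  | F, x :: l => unshuffleSum (fun u v => F (x :: u) v) l + unshuffleSum (fun u v => F u (x :: v)) l

@[simp]
theorem unshuffleSum_nil (F : List α → List α → M) : unshuffleSum F [] = F [] [] := rfl

theorem unshuffleSum_cons (F : List α → List α → M) (x : α) (l : List α) :
    unshuffleSum F (x :: l) =
      unshuffleSum (fun u v => F (x :: u) v) l + unshuffleSum (fun u v => F u (x :: v)) l := rfl

theorem unshuffleSum_congr {F G : List α → List α → M} {l : List α}
    (h : ∀ u v, u.length + v.length = l.length → F u v = G u v) :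
    unshuffleSum F l = unshuffleSum G l := by
  induction l generalizing F G with
  | nil => exact h [] [] rfl
  | cons x l ih =>
    rw [unshuffleSum_cons, unshuffleSum_cons]
    congr 1 <;> refine ih fun u v huv => h _ _ ?_ <;> simp only [List.length_cons] <;> omega

@[simp]
theorem unshuffleSum_zero (l : List α) : unshuffleSum (fun _ _ => (0 : M)) l = 0 := by
  induction l with
  | nil => rfl
  | cons x l ih => rw [unshuffleSum_cons, ih, add_zero]

theorem map_unshuffleSum {N : Type*} [AddCommMonoid N] (g : M →+ N) (F : List α → List α → M)
    (l : List α) : g (unshuffleSum F l) = unshuffleSum (fun u v => g (F u v)) l := by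
  induction l generalizing F with
  | nil => rfl
  | cons x l ih => simp only [unshuffleSum_cons, map_add, ih]

theorem unshuffleSum_sum {ι : Type*} (s : Finset ι) (F : ι → List α → List α → M) (l : List α) :
    unshuffleSum (fun u v => ∑ i ∈ s, F i u v) l = ∑ i ∈ s, unshuffleSum (F i) l := by
  induction l generalizing F with
  | nil => rfl
  | cons x l ih => simp only [unshuffleSum_cons, ih, Finset.sum_add_distrib]

theorem unshuffleSum_append (F : List α → List α → M) (l₁ l₂ : List α) :
    unshuffleSum F (l₁ ++ l₂) =
      unshuffleSum (fun u₁ v₁ => unshuffleSum (fun u₂ v₂ => F (u₁ ++ u₂) (v₁ ++ v₂)) l₂) l₁ := by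
  induction l₁ generalizing F with
  | nil => rfl
  | cons x l ih => simp only [List.cons_append, unshuffleSum_cons, ih]

theorem unshuffleSum_map (g : α → β) (F : List β → List β → M) (l : List α) :
    unshuffleSum F (l.map g) = unshuffleSum (fun u v => F (u.map g) (v.map g)) l := by
  induction l generalizing F with
  | nil => rfl
  | cons x l ih => simp only [List.map_cons, unshuffleSum_cons, ih]

/-- In a constant list only the lengths of the two parts matter, and each pair of lengths arises a
binomial number of times, by Pascal's rule. -/
theorem unshuffleSum_replicate (F : List α → List α → M) (x : α) (m : ℕ) :
    unshuffleSum F (List.replicate m x) = ∑ ij ∈ Finset.HasAntidiagonal.antidiagonal m,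
      m.choose ij.1 • F (List.replicate ij.1 x) (List.replicate ij.2 x) := by
  induction m generalizing F with
  | zero => simp
  | succ m ih =>
    rw [Finset.sum_antidiagonal_choose_succ_nsmul
      fun i j => F (List.replicate i x) (List.replicate j x)]
    simp only [List.replicate_succ, unshuffleSum_cons, ih]
    -- Pascal's rule yields its two sums in the opposite order, one of them with the binomial
    -- indexed by the second length; hence the swap here and the symmetry of binomials below.
    rw [add_comm]
    congr 1
    refine Finset.sum_congr rfl fun ij hij => ?_
    rw [Nat.choose_symm_of_eq_add (Finset.HasAntidiagonal.mem_antidiagonal.1 hij).symm]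

/-- Unshuffling positions amounts to choosing a subset. The induction adds a new minimum because
that becomes the head of the sorted list. -/
theorem unshuffleSum_sort [LinearOrder α] (F : List α → List α → M) (s : Finset α) :
    unshuffleSum F (s.sort (· ≤ ·)) =
      ∑ t ∈ s.powerset, F (t.sort (· ≤ ·)) ((s \ t).sort (· ≤ ·)) := by
  induction s using Finset.induction_on_min generalizing F with
  | empty => simp
  | insert a s ha ih =>
    have ha' : a ∉ s := fun h => (ha a h).false
    rw [Finset.sort_insert _ (fun b hb => (ha b hb).le) ha', unshuffleSum_cons, ih, ih,
      Finset.sum_powerset_insert ha', add_comm]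
    congr 1
    · refine Finset.sum_congr rfl fun t ht => ?_
      have hts := Finset.mem_powerset.1 ht
      rw [Finset.insert_sdiff_of_notMem _ (fun h => ha' (hts h)),
        Finset.sort_insert _ (fun b hb => (ha b (Finset.sdiff_subset hb)).le)
          (fun h => ha' (Finset.sdiff_subset h))]
    · refine Finset.sum_congr rfl fun t ht => ?_
      have hts := Finset.mem_powerset.1 ht
      rw [Finset.insert_sdiff_insert, Finset.sdiff_insert_of_notMem ha',
        Finset.sort_insert _ (fun b hb => (ha b (hts hb)).le) (fun h => ha' (hts h))]

/-- A product of sums of two families that commute with each other. -/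
theorem prod_map_add_of_commute {R : Type*} [Ring R] (g h : α → R)
    (hc : ∀ x y, Commute (h x) (g y)) (l : List α) :
    (l.map fun x => g x + h x).prod =
      unshuffleSum (fun u v => (u.map g).prod * (v.map h).prod) l := by
  induction l with
  | nil => simp
  | cons x l ih =>
    have e (u v : List α) : (u.map g).prod * (h x * (v.map h).prod) =
        h x * ((u.map g).prod * (v.map h).prod) := by
      have : Commute (h x) (u.map g).prod := by
        refine Commute.list_prod_right _ _ fun y hy => ?_
        obtain ⟨z, _, rfl⟩ := List.mem_map.1 hy
        exact hc x z
      rw [← mul_assoc, ← this.eq, mul_assoc]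
    simp only [List.map_cons, List.prod_cons, unshuffleSum_cons, ih, add_mul, mul_assoc, e]
    congr 1
    · exact map_unshuffleSum (AddMonoidHom.mulLeft (g x)) _ _
    · exact map_unshuffleSum (AddMonoidHom.mulLeft (h x)) _ _

end Unshuffle

/-! ### Convolution powers and the binomial theorem -/

section ConvPow

variable {α A : Type*} [Ring A]

open Classical in
/-- The `k`-th power of a function on lists for the convolution dual to unshuffling. -/
def convPow (φ : List α → A) : ℕ → List α → A
  | 0, l => if l = [] then 1 else 0
  | k + 1, l => unshuffleSum (fun u v => convPow φ k u * φ v) l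

theorem convPow_zero_nil (φ : List α → A) : convPow φ 0 [] = 1 := by simp [convPow]

theorem convPow_zero_cons (φ : List α → A) (x : α) (l : List α) : convPow φ 0 (x :: l) = 0 := by
  simp [convPow]

theorem convPow_succ (φ : List α → A) (k : ℕ) (l : List α) :
    convPow φ (k + 1) l = unshuffleSum (fun u v => convPow φ k u * φ v) l := rfl

theorem convPow_map {β : Type*} (g : α → β) (φ : List β → A) (k : ℕ) (l : List α) :
    convPow φ k (l.map g) = convPow (fun v => φ (v.map g)) k l := by
  induction k generalizing l with
  | zero => simp [convPow]
  | succ k ih => simp only [convPow_succ, unshuffleSum_map, ih]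

/-- Every slot must receive at least one entry, which is impossible with more slots than entries. -/
theorem convPow_eq_zero {φ : List α → A} (hφ : φ [] = 0) {k : ℕ} {l : List α}
    (h : l.length < k) : convPow φ k l = 0 := by
  induction k generalizing l with
  | zero => omega
  | succ k ih =>
    rw [convPow_succ, ← unshuffleSum_zero l]
    refine unshuffleSum_congr fun u v huv => ?_
    rcases v with _ | ⟨x, v⟩
    · rw [hφ, mul_zero]
    · rw [List.length_cons] at huv
      rw [ih (by omega), zero_mul]

open Classical in
/-- The ordered product of a list, with the value at the empty list changed to zero. -/
def prodNonempty (v : List A) : A := if v = [] then 0 else v.prod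

theorem prodNonempty_nil : prodNonempty ([] : List A) = 0 := by simp [prodNonempty]

theorem prodNonempty_of_ne {v : List A} (h : v ≠ []) : prodNonempty v = v.prod := by
  simp [prodNonempty, h]

/-- Convolving with the unit returns `f`: the only unshuffle with `v` empty has `u = l`. This is the
splitting of the ordered product into the unit and `prodNonempty`. -/
theorem unshuffleSum_mul_prod (f : List A → A) (l : List A) :
    unshuffleSum (fun u v => f u * v.prod) l =
      f l + unshuffleSum (fun u v => f u * prodNonempty v) l := by
  induction l generalizing f with
  | nil => simp [prodNonempty_nil]
  | cons x l ih =>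
    have e (v : List A) : prodNonempty (x :: v) = (x :: v).prod :=
      prodNonempty_of_ne (List.cons_ne_nil _ _)
    simp only [unshuffleSum_cons, ih fun u => f (x :: u), e, add_assoc]

/-- Binomial theorem for unit plus `prodNonempty`; the unit commutes with everything, so Pascal's
rule suffices even though `A` is noncommutative. -/
theorem convPow_prod_eq_sum (N : ℕ) (l : List A) :
    convPow List.prod N l = ∑ k ∈ Finset.range (N + 1), N.choose k • convPow prodNonempty k l := by
  induction N generalizing l with
  | zero => simp [convPow]
  | succ N ih =>
    rw [convPow_succ, unshuffleSum_mul_prod, Finset.sum_range_succ']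
    simp only [Nat.choose_succ_succ, add_smul, Finset.sum_add_distrib]
    have e : unshuffleSum (fun u v => convPow List.prod N u * prodNonempty v) l =
        ∑ k ∈ Finset.range (N + 1), N.choose k • convPow prodNonempty (k + 1) l := by
      simp only [ih, Finset.sum_mul, unshuffleSum_sum]
      refine Finset.sum_congr rfl fun k _ => ?_
      rw [convPow_succ]
      have := map_unshuffleSum (nsmulAddMonoidHom (α := A) (N.choose k))
        (fun u v => convPow prodNonempty k u * prodNonempty v) l
      simp only [nsmulAddMonoidHom_apply] at this
      simp only [this, smul_mul_assoc]
    -- The extra top term carries `N.choose (N + 1) = 0`; it makes the ranges agree for Pascal's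
    -- rule.
    have e2 : convPow List.prod N l = ∑ k ∈ Finset.range (N + 1),
        N.choose (k + 1) • convPow prodNonempty (k + 1) l +
          (N + 1).choose 0 • convPow prodNonempty 0 l := by
      rw [ih, Finset.sum_range_succ', Finset.sum_range_succ _ N, Nat.choose_succ_self]
      simp
    rw [e, e2]
    abel

/-- A summation range free of `N` is what makes the right side polynomial in `N`. Terms beyond
either range vanish: by length on one side, by the binomial on the other. -/
theorem convPow_prod_eq_sum_length (N : ℕ) (l : List A) :
    convPow List.prod N l =
      ∑ k ∈ Finset.range (l.length + 1), N.choose k • convPow prodNonempty k l := by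
  rw [convPow_prod_eq_sum]
  refine Finset.sum_congr_of_eq_on_inter ?_ ?_ fun _ _ _ => rfl
  · intro k _ hk
    rw [convPow_eq_zero prodNonempty_nil (by simpa using hk), smul_zero]
  · intro k _ hk
    rw [Nat.choose_eq_zero_of_lt (by simpa using hk), zero_smul]

end ConvPow

/-! ### Moments in tensor powers as convolution powers -/

section Tensor

variable {A : Type*} [Ring A] [Algebra ℂ A]

/-- The sum of the copies of `x` in the components of the `k`-th tensor power. -/
def primitive (k : ℕ) (x : A) : ⨂[ℂ] _ : Fin k, A := ∑ j, PiTensorProduct.singleAlgHom j x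

theorem singleAlgHom_eq_tprod {k : ℕ} (j : Fin k) (x : A) :
    PiTensorProduct.singleAlgHom (R := ℂ) (A := fun _ : Fin k => A) j x =
      PiTensorProduct.tprod ℂ fun m : Fin k => if m = j then x else 1 := by
  rw [PiTensorProduct.singleAlgHom_apply]
  congr 1
  ext m
  by_cases h : m = j
  · subst h; simp
  · simp [h]

theorem pad_singleAlgHom (k : ℕ) (j : Fin k) (x : A) :
    pad A k (k + 1) k.le_succ (PiTensorProduct.singleAlgHom j x) =
      PiTensorProduct.singleAlgHom j.castSucc x := by
  rw [singleAlgHom_eq_tprod, singleAlgHom_eq_tprod, pad_tprod]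
  congr 1
  ext m
  refine Fin.lastCases ?_ (fun i => ?_) m
  · simp [(Fin.castSucc_lt_last j).ne']
  · simp [Fin.castSucc_inj]

theorem primitive_succ (k : ℕ) (x : A) :
    primitive (k + 1) x = pad A k (k + 1) k.le_succ (primitive k x) +
      PiTensorProduct.singleAlgHom (Fin.last k) x := by
  rw [primitive, Fin.sum_univ_castSucc, primitive, map_sum]
  simp only [pad_singleAlgHom]

theorem tprod_snoc_eq (k : ℕ) (x : Fin k → A) (y : A) :
    pad A k (k + 1) k.le_succ (PiTensorProduct.tprod ℂ x) *
        PiTensorProduct.singleAlgHom (Fin.last k) y =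
      PiTensorProduct.tprod ℂ (Fin.snoc x y : Fin (k + 1) → A) := by
  rw [pad_tprod, singleAlgHom_eq_tprod, PiTensorProduct.tprod_mul_tprod]
  congr 1
  ext m
  refine Fin.lastCases ?_ (fun i => ?_) m
  · simp
  · simp [(Fin.castSucc_lt_last i).ne]

theorem singleAlgHom_last_commute_pad (k : ℕ) (x : A) (t : ⨂[ℂ] _ : Fin k, A) :
    Commute (PiTensorProduct.singleAlgHom (Fin.last k) x) (pad A k (k + 1) k.le_succ t) := by
  induction t using PiTensorProduct.induction_on with
  | smul_tprod r t =>
    rw [map_smul]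
    refine Commute.smul_right ?_ r
    rw [Commute, SemiconjBy, tprod_snoc_eq, pad_tprod, singleAlgHom_eq_tprod,
      PiTensorProduct.tprod_mul_tprod]
    congr 1
    ext m
    refine Fin.lastCases ?_ (fun i => ?_) m
    · simp
    · simp [(Fin.castSucc_lt_last i).ne]
  | add s t hs ht =>
    rw [map_add]
    exact hs.add_right ht

/-- The last tensor component is the rightmost factor of the concatenation, so it splits off on the
right. -/
theorem conc_map_pad_mul_singleAlgHom (f : A →ₗ[ℂ] A) (k : ℕ) (t : ⨂[ℂ] _ : Fin k, A) (y : A) :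
    conc A (k + 1) (PiTensorProduct.map (fun _ => f) (pad A k (k + 1) k.le_succ t *
        PiTensorProduct.singleAlgHom (Fin.last k) y)) =
      conc A k (PiTensorProduct.map (fun _ => f) t) * f y := by
  induction t using PiTensorProduct.induction_on with
  | smul_tprod r t =>
    rw [map_smul, smul_mul_assoc, tprod_snoc_eq]
    simp only [map_smul, PiTensorProduct.map_tprod, conc_tprod, smul_mul_assoc]
    rw [List.ofFn_succ', List.concat_eq_append]
    simp
  | add s t hs ht => simp only [map_add, add_mul, hs, ht]

/-- Common source of the moment formula (`f` the identity) and of the Lie projector (`f = Id - ε`).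
The sum over `k + 1` components is the padded sum over `k` plus the last copy. These commute, so the
product unshuffles, and the last component is the new slot. -/
theorem conc_map_prod_primitive {α : Type*} (f : A →ₗ[ℂ] A) (X : α → A) (k : ℕ) (l : List α) :
    conc A k (PiTensorProduct.map (fun _ => f) (l.map fun x => primitive k (X x)).prod) =
      convPow (fun v => f (v.map X).prod) k l := by
  induction k generalizing l with
  | zero =>
    cases l with
    | nil =>
      rw [convPow_zero_nil, List.map_nil, List.prod_nil, PiTensorProduct.one_def,
        PiTensorProduct.map_tprod, conc_tprod]
      rfl
    | cons x l =>
      rw [convPow_zero_cons, List.map_cons, List.prod_cons, primitive, Finset.univ_eq_empty,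
        Finset.sum_empty, zero_mul, map_zero, map_zero]
  | succ k ih =>
    simp only [primitive_succ]
    rw [prod_map_add_of_commute _ _ fun x y => singleAlgHom_last_commute_pad k _ _]
    have := map_unshuffleSum
      ((conc A (k + 1) ∘ₗ PiTensorProduct.map fun _ => f).toAddMonoidHom)
      (fun u v => (u.map fun x => pad A k (k + 1) k.le_succ (primitive k (X x))).prod *
        (v.map fun x => PiTensorProduct.singleAlgHom (Fin.last k) (X x)).prod) l
    simp only [LinearMap.toAddMonoidHom_coe, LinearMap.comp_apply] at this
    rw [this, convPow_succ]
    refine unshuffleSum_congr fun u v _ => ?_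
    have e₁ : (u.map fun x => pad A k (k + 1) k.le_succ (primitive k (X x))).prod =
        pad A k (k + 1) k.le_succ (u.map fun x => primitive k (X x)).prod := by
      rw [map_list_prod, List.map_map]; rfl
    have e₂ : (v.map fun x => PiTensorProduct.singleAlgHom (R := ℂ) (A := fun _ => A)
        (Fin.last k) (X x)).prod =
        PiTensorProduct.singleAlgHom (Fin.last k) (v.map X).prod := by
      rw [map_list_prod, List.map_map]; rfl
    rw [e₁, e₂, conc_map_pad_mul_singleAlgHom, ih]

theorem system_dot_eq (N : ℕ) (x : A) :
    (system A).dot N x = DirectLimit.Module.of ℂ ℕ _ (pad A) N (primitive N x) := by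
  rw [primitive, map_sum, SpreadabilitySystem.dot, Finset.sum_range]
  refine Finset.sum_congr rfl fun j _ => ?_
  refine (embed_eq j.1 N j.2 x).trans ?_
  rw [singleAlgHom_eq_tprod]
  simp only [Fin.ext_iff]
  rfl

theorem system_dotMoment_eq {n : ℕ} (X : Fin n → A) (N : ℕ) :
    (system A).dotMoment X N = convPow List.prod N (List.ofFn X) := by
  have e : (List.ofFn fun k => (system A).dot N (X k)).prod =
      (⟦⟨N, ((List.ofFn X).map (primitive N)).prod⟩⟧ : InfTensor A) := by
    have : (List.ofFn fun k => (system A).dot N (X k)) =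
        (List.ofFn X).map ((system A).dot N) := by
      rw [List.map_ofFn]; rfl
    rw [this]
    generalize List.ofFn X = l
    induction l with
    | nil => exact DirectLimit.one_def N
    | cons x l ih =>
      rw [List.map_cons, List.prod_cons, ih, List.map_cons, List.prod_cons, system_dot_eq]
      exact DirectLimit.mul_def _ _ _
  have h := conc_map_prod_primitive (LinearMap.id : A →ₗ[ℂ] A) id N (List.ofFn X)
  rw [PiTensorProduct.map_id] at h
  rw [SpreadabilitySystem.dotMoment, e]
  refine (concInf_mk A N _).trans ?_
  simpa using h

end Tensor

/-! ### The moment polynomial and its linear coefficient -/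

section Cumulant

open Polynomial

/-- The polynomial `N ↦ N.choose k`. -/
def choosePoly (k : ℕ) : ℂ[X] := C ((k.factorial : ℂ)⁻¹) * descPochhammer ℂ k

theorem choosePoly_eval (k N : ℕ) : (choosePoly k).eval (N : ℂ) = N.choose k := by
  rw [choosePoly, eval_C_mul, descPochhammer_eval_eq_descFactorial,
    Nat.descFactorial_eq_factorial_mul_choose]
  push_cast
  rw [inv_mul_cancel_left₀ (Nat.cast_ne_zero.2 k.factorial_ne_zero)]

/-- In x(x-1)⋯(x-k) the linear term takes x from the first factor and -1, …, -k from the others. -/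
theorem descPochhammer_coeff_one (k : ℕ) :
    (descPochhammer ℂ (k + 1)).coeff 1 = (-1) ^ k * (k.factorial : ℂ) := by
  induction k with
  | zero => simp
  | succ k ih =>
    have h0 : (descPochhammer ℂ (k + 1)).coeff 0 = 0 := by
      rw [coeff_zero_eq_eval_zero, descPochhammer_ne_zero_eval_zero _ k.succ_ne_zero]
    rw [descPochhammer_succ_right, mul_sub, coeff_sub, coeff_mul_X, h0, ← C_eq_natCast, coeff_mul_C,
      ih, Nat.factorial_succ]
    push_cast
    ring

theorem choosePoly_coeff_one_zero : (choosePoly 0).coeff 1 = 0 := by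
  simp [choosePoly, coeff_one]

theorem choosePoly_coeff_one_succ (k : ℕ) :
    (choosePoly (k + 1)).coeff 1 = (-1) ^ k / ((k : ℂ) + 1) := by
  have h1 : (k.factorial : ℂ) ≠ 0 := Nat.cast_ne_zero.2 k.factorial_ne_zero
  have h2 : (k : ℂ) + 1 ≠ 0 := by exact_mod_cast k.succ_ne_zero
  rw [choosePoly, coeff_C_mul, descPochhammer_coeff_one, Nat.factorial_succ]
  push_cast
  field_simp

variable {A : Type*} [Ring A] [Algebra ℂ A]

/-- Counting roots is unavailable over a ring that may be noncommutative and have zero divisors.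
Applying a linear functional to the coefficients gives a complex polynomial with infinitely many
roots, and functionals separate points. -/
theorem polynomial_eq_zero_of_eval_natCast {P : A[X]} (h : ∀ N : ℕ, 0 < N → P.eval (N : A) = 0) :
    P = 0 := by
  ext i
  rw [coeff_zero, ← Module.forall_dual_apply_eq_zero_iff ℂ]
  intro ψ
  let Q : ℂ[X] := ∑ j ∈ Finset.range (P.natDegree + 1), monomial j (ψ (P.coeff j))
  have hQ : Q = 0 := by
    refine eq_zero_of_infinite_isRoot Q (Set.Infinite.mono ?_
      (Set.infinite_range_of_injective (f := fun N : ℕ => ((N + 1 : ℕ) : ℂ)) ?_))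
    · rintro _ ⟨N, rfl⟩
      have hN := congrArg ψ (h (N + 1) N.succ_pos)
      rw [eval_eq_sum_range, map_sum, map_zero] at hN
      change Q.eval _ = 0
      rw [eval_finsetSum, ← hN]
      refine Finset.sum_congr rfl fun j _ => ?_
      -- The evaluation points are central scalars, so the functional passes through their powers.
      have e : (((N + 1 : ℕ) : A)) ^ j = algebraMap ℂ A (((N + 1 : ℕ) : ℂ) ^ j) := by simp
      rw [e, ← Algebra.commutes, ← Algebra.smul_def, map_smul, eval_monomial, smul_eq_mul, mul_comm]
    · intro a b hab
      have : a + 1 = b + 1 := Nat.cast_injective hab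
      omega
  have hi := congrArg (fun q => q.coeff i) hQ
  simp only [Q, finsetSum_coeff, coeff_monomial, Finset.sum_ite_eq', Finset.mem_range,
    coeff_zero] at hi
  by_cases hd : i < P.natDegree + 1
  · rwa [if_pos hd] at hi
  · rw [coeff_eq_zero_of_natDegree_lt (by omega), map_zero]

/-- The polynomial that computes the moments of the dot operation. -/
def dotPolynomial (l : List A) : A[X] :=
  ∑ k ∈ Finset.range (l.length + 1),
    C (convPow prodNonempty k l) * (choosePoly k).map (algebraMap ℂ A)

theorem isDotPolynomial_dotPolynomial {n : ℕ} (X : Fin n → A) :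
    (system A).IsDotPolynomial X (dotPolynomial (List.ofFn X)) := by
  intro N _
  rw [system_dotMoment_eq, convPow_prod_eq_sum_length, dotPolynomial, eval_finsetSum]
  refine Finset.sum_congr rfl fun k _ => ?_
  rw [eval_C_mul, ← map_natCast (algebraMap ℂ A) N, eval_map_apply, choosePoly_eval, map_natCast,
    nsmul_eq_mul, Nat.cast_comm]

theorem isDotPolynomial_unique {n : ℕ} {X : Fin n → A} {P Q : A[X]}
    (hP : (system A).IsDotPolynomial X P) (hQ : (system A).IsDotPolynomial X Q) : P = Q :=
  sub_eq_zero.1 (polynomial_eq_zero_of_eval_natCast fun N hN => by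
    rw [eval_sub, hP N hN, hQ N hN, sub_self])

/-- By uniqueness the polynomial chosen in the definition is `dotPolynomial`, whose linear
coefficient is read off from the binomials. The term of index 0 is constant in `N` and drops out,
hence the shift to `k + 1`. -/
theorem K_eq_sum {n : ℕ} (X : Fin n → A) :
    K A X = ∑ k ∈ Finset.range n,
      ((-1 : ℂ) ^ k / (k + 1)) • convPow prodNonempty (k + 1) (List.ofFn X) := by
  have h : ∃ P : A[X], (system A).IsDotPolynomial X P := ⟨_, isDotPolynomial_dotPolynomial X⟩
  rw [K, SpreadabilitySystem.cumulant, dif_pos h,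
    isDotPolynomial_unique h.choose_spec (isDotPolynomial_dotPolynomial X), dotPolynomial,
    finsetSum_coeff, Finset.sum_range_succ', List.length_ofFn]
  simp only [coeff_C_mul, coeff_map, choosePoly_coeff_one_zero, choosePoly_coeff_one_succ, map_zero,
    mul_zero, add_zero]
  refine Finset.sum_congr rfl fun k _ => ?_
  rw [← Algebra.commutes, ← Algebra.smul_def]

end Cumulant

/-! ### The Lie projector on words -/

section FreeAlgebra

variable {L : Type*}

theorem counit_prod_letter (v : List L) :
    counit L (v.map letter).prod = if v = [] then 1 else 0 := by
  cases v with
  | nil => simp [counit, MonoidAlgebra.one_def]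
  | cons x v => simp [counit, letter]

/-- Identifies the convolution of endomorphisms with that of functions on words: `Id - ε` restricts
to `prodNonempty`. -/
theorem id_sub_counit_prod_letter (v : List L) :
    (LinearMap.id - counit L : FreeAlg L →ₗ[ℂ] FreeAlg L) (v.map letter).prod =
      prodNonempty (v.map letter) := by
  rw [LinearMap.sub_apply, LinearMap.id_apply, counit_prod_letter]
  cases v with
  | nil => simp [prodNonempty_nil]
  | cons x v =>
    rw [if_neg (List.cons_ne_nil _ _), sub_zero, prodNonempty_of_ne (by simp)]

theorem coprod_prod_letter (k : ℕ) (l : List L) :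
    coprod L k (l.map letter).prod = (l.map fun x => primitive k (letter x)).prod := by
  rw [map_list_prod, List.map_map]
  congr 2
  ext x
  simp [coprod, letter, primitive]

theorem convolution_prod_letter (k : ℕ) (l : List L) :
    convolution (fun _ : Fin k => LinearMap.id - counit L) (l.map letter).prod =
      convPow prodNonempty k (l.map letter) := by
  rw [convolution, LinearMap.comp_apply, LinearMap.comp_apply, AlgHom.toLinearMap_apply,
    coprod_prod_letter, conc_map_prod_primitive, convPow_map]
  simp only [id_sub_counit_prod_letter]

theorem lieTerm_prod_letter (l : List L) (k : ℕ) :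
    lieTerm (l.map letter).prod k =
      ((-1 : ℂ) ^ k / (k + 1)) • convPow prodNonempty (k + 1) (l.map letter) := by
  rw [lieTerm, convolution_prod_letter]

theorem support_lieTerm_prod_letter (l : List L) :
    Function.support (lieTerm (l.map letter).prod) ⊆ Finset.range l.length := by
  intro k hk
  rw [Finset.coe_range, Set.mem_Iio]
  by_contra hlt
  refine hk ?_
  rw [lieTerm_prod_letter, convPow_eq_zero prodNonempty_nil (by simp; omega), smul_zero]

theorem K_letter_eq_lieProj {n : ℕ} (a : Fin n → L) :
    K (FreeAlg L) (fun k => letter (a k)) = lieProj (List.ofFn fun k => letter (a k)).prod := by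
  have e : (List.ofFn fun k => letter (a k)) = (List.ofFn a).map letter := by
    rw [List.map_ofFn]; rfl
  rw [K_eq_sum, lieProj, e, finsum_eq_sum_of_support_subset _ (support_lieTerm_prod_letter _),
    List.length_ofFn]
  simp only [lieTerm_prod_letter]

end FreeAlgebra

/-! ### Ordered set partitions -/

section OrderedPartitions

variable {α : Type*} [LinearOrder α]

/-- The ordered set partitions of a finite set into `k` blocks. -/
def orderedPartitions : ℕ → Finset α → Finset (List (Finset α))
  | 0, s => if s = ∅ then {[]} else ∅
  | k + 1, s => ((s.powerset.filter fun t => (s \ t).Nonempty).sigma fun t =>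
      orderedPartitions k t).image fun x => x.2 ++ [s \ x.1]

theorem mem_orderedPartitions_zero {s : Finset α} {π : List (Finset α)} :
    π ∈ orderedPartitions 0 s ↔ s = ∅ ∧ π = [] := by
  rw [orderedPartitions]
  split_ifs with h <;> simp [h]

theorem mem_orderedPartitions_succ {k : ℕ} {s : Finset α} {π : List (Finset α)} :
    π ∈ orderedPartitions (k + 1) s ↔
      ∃ t ⊆ s, (s \ t).Nonempty ∧ ∃ ρ ∈ orderedPartitions k t, ρ ++ [s \ t] = π := by
  simp only [orderedPartitions, Finset.mem_image, Finset.mem_sigma, Finset.mem_filter,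
    Finset.mem_powerset, Sigma.exists]
  constructor
  · rintro ⟨t, ρ, ⟨⟨h1, h2⟩, h3⟩, h4⟩
    exact ⟨t, h1, h2, ρ, h3, h4⟩
  · rintro ⟨t, h1, h2, ρ, h3, h4⟩
    exact ⟨t, ρ, ⟨⟨h1, h2⟩, h3⟩, h4⟩

theorem sum_orderedPartitions_succ {M : Type*} [AddCommMonoid M] (g : List (Finset α) → M) (k : ℕ)
    (s : Finset α) :
    ∑ π ∈ orderedPartitions (k + 1) s, g π =
      ∑ t ∈ s.powerset.filter fun t => (s \ t).Nonempty,
        ∑ ρ ∈ orderedPartitions k t, g (ρ ++ [s \ t]) := by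
  rw [orderedPartitions, Finset.sum_image, Finset.sum_sigma]
  rintro ⟨t, ρ⟩ h ⟨t', ρ'⟩ h' e
  simp only [Finset.coe_sigma, Set.mem_sigma_iff, Finset.mem_coe, Finset.mem_filter,
    Finset.mem_powerset] at h h'
  obtain ⟨e1, e2⟩ := List.append_inj' e rfl
  simp only at e1 e2
  -- The last block determines the union of the earlier ones as its complement, so appending it is
  -- injective.
  have : t = t' := by
    rw [← Finset.sdiff_sdiff_eq_self h.1.1, ← Finset.sdiff_sdiff_eq_self h'.1.1,
      List.singleton_inj.1 e2]
  subst this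
  rw [e1]

theorem card_of_mem_orderedPartitions {k : ℕ} {s : Finset α} {π : List (Finset α)}
    (h : π ∈ orderedPartitions k s) : k ≤ s.card := by
  induction k generalizing s π with
  | zero => exact Nat.zero_le _
  | succ k ih =>
    obtain ⟨t, hts, hne, ρ, hρ, -⟩ := mem_orderedPartitions_succ.1 h
    have h1 := ih hρ
    have h2 := Finset.card_sdiff_add_card_eq_card hts
    have h3 := hne.card_pos
    omega

theorem mem_orderedPartitions {k : ℕ} {s : Finset α} {π : List (Finset α)} :
    π ∈ orderedPartitions k s ↔ π.length = k ∧ (∀ P ∈ π, P.Nonempty) ∧ π.Pairwise Disjoint ∧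
      ∀ x, x ∈ s ↔ ∃ P ∈ π, x ∈ P := by
  induction k generalizing s π with
  | zero =>
    rw [mem_orderedPartitions_zero, List.length_eq_zero_iff]
    constructor
    · rintro ⟨rfl, rfl⟩
      simp
    · rintro ⟨rfl, -, -, h⟩
      refine ⟨?_, rfl⟩
      ext x
      simpa using h x
  | succ k ih =>
    rw [mem_orderedPartitions_succ]
    constructor
    · rintro ⟨t, hts, hne, ρ, hρ, rfl⟩
      obtain ⟨h1, h2, h3, h4⟩ := ih.1 hρ
      refine ⟨by simp [h1], ?_, ?_, fun x => ?_⟩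
      · intro P hP
        rcases List.mem_append.1 hP with h | h
        · exact h2 P h
        · rwa [List.mem_singleton.1 h]
      · rw [List.pairwise_append]
        refine ⟨h3, List.pairwise_singleton _ _, fun P hP Q hQ => ?_⟩
        rw [List.mem_singleton.1 hQ]
        refine Finset.disjoint_left.2 fun x hx hx' => ?_
        exact (Finset.mem_sdiff.1 hx').2 ((h4 x).2 ⟨P, hP, hx⟩)
      · constructor
        · intro hx
          by_cases hxt : x ∈ t
          · obtain ⟨P, hP, hxP⟩ := (h4 x).1 hxt
            exact ⟨P, List.mem_append_left _ hP, hxP⟩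
          · exact ⟨s \ t, by simp, Finset.mem_sdiff.2 ⟨hx, hxt⟩⟩
        · rintro ⟨P, hP, hxP⟩
          rcases List.mem_append.1 hP with h | h
          · exact hts ((h4 x).2 ⟨P, h, hxP⟩)
          · rw [List.mem_singleton.1 h] at hxP
            exact Finset.sdiff_subset hxP
    · rintro ⟨h1, h2, h3, h4⟩
      obtain rfl | ⟨ρ, P, rfl⟩ := List.eq_nil_or_concat π
      · simp at h1
      rw [List.concat_eq_append] at *
      have hPs : P ⊆ s := fun x hx => (h4 x).2 ⟨P, by simp, hx⟩
      rw [List.pairwise_append] at h3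
      have e : s \ (s \ P) = P := Finset.sdiff_sdiff_eq_self hPs
      -- The earlier blocks partition the complement of the last block `P`.
      refine ⟨s \ P, Finset.sdiff_subset, ?_, ρ, ih.2 ⟨?_, ?_, h3.1, fun x => ?_⟩, ?_⟩
      · rw [e]
        exact h2 P (by simp)
      · simpa using h1
      · exact fun Q hQ => h2 Q (List.mem_append_left _ hQ)
      · rw [Finset.mem_sdiff, h4]
        constructor
        · rintro ⟨⟨Q, hQ, hx⟩, hxP⟩
          rcases List.mem_append.1 hQ with h | h
          · exact ⟨Q, h, hx⟩
          · rw [List.mem_singleton.1 h] at hx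
            exact absurd hx hxP
        · rintro ⟨Q, hQ, hx⟩
          exact ⟨⟨Q, List.mem_append_left _ hQ, hx⟩,
            Finset.disjoint_left.1 (h3.2.2 Q hQ P (by simp)) hx⟩
      · rw [e]

/-- Each step chooses the subset `t` left to the first `k` slots; the last block is `s \ t`, and the
terms where it is empty are killed by `prodNonempty`. -/
theorem convPow_prodNonempty_sort {A : Type*} [Ring A] (X : α → A) (k : ℕ) (s : Finset α) :
    convPow prodNonempty k ((s.sort (· ≤ ·)).map X) =
      ∑ π ∈ orderedPartitions k s, (π.map fun P => ((P.sort (· ≤ ·)).map X).prod).prod := by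
  induction k generalizing s with
  | zero =>
    by_cases h : s = ∅
    · subst h
      simp [orderedPartitions, convPow]
    · have : s.sort (· ≤ ·) ≠ [] := fun e => h (by simpa using congrArg List.length e)
      simp only [orderedPartitions, convPow, if_neg h, List.map_eq_nil_iff, if_neg this,
        Finset.sum_empty]
  | succ k ih =>
    rw [sum_orderedPartitions_succ, convPow_succ, unshuffleSum_map, unshuffleSum_sort,
      Finset.sum_filter]
    refine Finset.sum_congr rfl fun t _ => ?_
    split_ifs with h
    · rw [ih, Finset.sum_mul, prodNonempty_of_ne]
      · simp
      · intro e
        have := congrArg List.length e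
        simp only [List.length_map, Finset.length_sort, List.length_nil] at this
        exact h.card_pos.ne' this
    · rw [Finset.not_nonempty_iff_eq_empty.1 h]
      simp [prodNonempty_nil]

theorem sum_OP {M : Type*} [AddCommMonoid M] {n : ℕ} (hn : 0 < n)
    (g : List (Finset (Fin n)) → M) :
    ∑ π : OP n, g π.1 =
      ∑ k ∈ Finset.range n, ∑ π ∈ orderedPartitions (k + 1) Finset.univ, g π := by
  rw [← Finset.sum_biUnion]
  · refine (Finset.sum_map Finset.univ
      (⟨Subtype.val, Subtype.val_injective⟩ : OP n ↪ List (Finset (Fin n))) g).symm.trans ?_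
    refine Finset.sum_congr ?_ fun _ _ => rfl
    ext π
    simp only [Finset.mem_map, Finset.mem_univ, true_and, Finset.mem_biUnion, Finset.mem_range]
    constructor
    · rintro ⟨⟨π, h1, h2, h3⟩, rfl⟩
      have hmem : π ∈ orderedPartitions π.length (Finset.univ : Finset (Fin n)) :=
        mem_orderedPartitions.2 ⟨rfl, h1, h2, fun x => by simpa using h3 x⟩
      have hlen := card_of_mem_orderedPartitions hmem
      rw [Finset.card_fin] at hlen
      -- The element 0 lies in some block, which excludes the empty sequence; this is where `n > 0`
      -- enters.
      obtain ⟨P, hP, -⟩ := h3 ⟨0, hn⟩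
      have hpos := List.length_pos_of_mem hP
      obtain ⟨k, hk⟩ := Nat.exists_eq_add_one.2 hpos
      exact ⟨k, by omega, hk ▸ hmem⟩
    · rintro ⟨k, -, hπ⟩
      obtain ⟨-, h1, h2, h3⟩ := mem_orderedPartitions.1 hπ
      exact ⟨⟨π, h1, h2, fun x => (h3 x).1 (Finset.mem_univ x)⟩, rfl⟩
  · intro i _ j _ hij
    refine Finset.disjoint_left.2 fun π hi hj => hij ?_
    have h1 := (mem_orderedPartitions.1 hi).1
    have h2 := (mem_orderedPartitions.1 hj).1
    omega

end OrderedPartitions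

/-! ### Unshuffling words with repeated letters -/

section Repeated

open Finset.HasAntidiagonal (antidiagonal mem_antidiagonal)

variable {α A M : Type*} [AddCommMonoid M]

/-- The list in which `a i` is repeated `p i` times. -/
def repeatList {n : ℕ} (a : Fin n → α) (p : Fin n → ℕ) : List α :=
  (List.finRange n).flatMap fun i => List.replicate (p i) (a i)

theorem repeatList_succ {n : ℕ} (a : Fin (n + 1) → α) (p : Fin (n + 1) → ℕ) :
    repeatList a p = List.replicate (p 0) (a 0) ++
      repeatList (fun i => a i.succ) fun i => p i.succ := by
  rw [repeatList, List.finRange_succ, List.flatMap_cons, List.flatMap_map]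
  rfl

theorem sum_piFinset_succ {n : ℕ} {γ : Type*} (s : Fin (n + 1) → Finset γ)
    (g : (Fin (n + 1) → γ) → M) :
    ∑ x ∈ Fintype.piFinset s, g x =
      ∑ y ∈ s 0, ∑ z ∈ Fintype.piFinset fun i => s i.succ, g (Fin.cons y z) := by
  rw [← Finset.sum_product']
  refine Finset.sum_nbij' (fun x => (x 0, Fin.tail x)) (fun y => Fin.cons y.1 y.2) ?_ ?_ ?_ ?_ ?_
  · intro x hx
    rw [Fintype.mem_piFinset] at hx
    exact Finset.mem_product.2 ⟨hx 0, Fintype.mem_piFinset.2 fun i => hx i.succ⟩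
  · rintro ⟨y, z⟩ h
    obtain ⟨hy, hz⟩ := Finset.mem_product.1 h
    rw [Fintype.mem_piFinset] at hz ⊢
    exact Fin.cases hy hz
  · exact fun x _ => Fin.cons_self_tail x
  · exact fun y _ => by simp
  · exact fun x _ => by rw [Fin.cons_self_tail]

/-- The constant runs are unshuffled independently, which multiplies their binomials. Plain
functions as exponents let the induction on `n` peel off the first run. -/
theorem unshuffleSum_repeatList {n : ℕ} (F : List α → List α → M) (a : Fin n → α)
    (p : Fin n → ℕ) :
    unshuffleSum F (repeatList a p) =
      ∑ x ∈ Fintype.piFinset fun i => antidiagonal (p i), (∏ i, (p i).choose (x i).1) •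
        F (repeatList a fun i => (x i).1) (repeatList a fun i => (x i).2) := by
  induction n generalizing F with
  | zero => simp [repeatList]
  | succ n ih =>
    rw [repeatList_succ, unshuffleSum_append, unshuffleSum_replicate, sum_piFinset_succ]
    refine Finset.sum_congr rfl fun y _ => ?_
    rw [ih, Finset.smul_sum]
    refine Finset.sum_congr rfl fun z _ => ?_
    rw [smul_smul, Fin.prod_univ_succ]
    simp only [repeatList_succ, Fin.cons_zero, Fin.cons_succ]

/-- Puts the sum on the antidiagonal of exponents, the index set for the coefficients of a product
of power series. -/
theorem unshuffleSum_repeated {n : ℕ} (F : List A → List A → M) (a : Fin n → A)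
    (p : Fin n →₀ ℕ) :
    unshuffleSum F (repeated a p) =
      ∑ x ∈ antidiagonal p, (∏ i, (p i).choose (x.1 i)) •
        F (repeated a x.1) (repeated a x.2) := by
  refine (unshuffleSum_repeatList F a p).trans ?_
  refine Finset.sum_nbij' (fun x => (Finsupp.equivFunOnFinite.symm fun i => (x i).1,
    Finsupp.equivFunOnFinite.symm fun i => (x i).2)) (fun y i => (y.1 i, y.2 i)) ?_ ?_ ?_ ?_ ?_
  · intro x hx
    rw [Fintype.mem_piFinset] at hx
    rw [mem_antidiagonal]
    ext i
    exact mem_antidiagonal.1 (hx i)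
  · intro y hy
    rw [Fintype.mem_piFinset]
    intro i
    rw [mem_antidiagonal] at hy ⊢
    exact DFunLike.congr_fun hy i
  · intro x _
    rfl
  · intro y _
    ext i <;> rfl
  · intro x _
    rfl

theorem repeated_eq_nil_iff {n : ℕ} {a : Fin n → A} {p : Fin n →₀ ℕ} :
    repeated a p = [] ↔ p = 0 := by
  simp [repeated, List.flatMap_eq_nil_iff, Finsupp.ext_iff]

theorem prod_repeated [Monoid A] {n : ℕ} (a : Fin n → A) (p : Fin n →₀ ℕ) :
    (repeated a p).prod = ((List.finRange n).map fun i => a i ^ p i).prod := by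
  rw [repeated]
  induction List.finRange n with
  | nil => rfl
  | cons i s ih => simp [ih]

end Repeated

/-! ### Coefficients of the logarithm of a product of exponentials -/

section CBH

open Finset.HasAntidiagonal (antidiagonal mem_antidiagonal)

variable {σ A : Type*} [Ring A] [Algebra ℂ A]

theorem monomial_single_pow {R : Type*} [Ring R] (i : σ) (x : R) (k : ℕ) :
    MvPowerSeries.monomial (Finsupp.single i 1) x ^ k =
      MvPowerSeries.monomial (Finsupp.single i k) (x ^ k) := by
  induction k with
  | zero => simp
  | succ k ih => rw [pow_succ, ih, MvPowerSeries.monomial_mul_monomial,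
      ← Finsupp.single_add, pow_succ]

theorem coeff_expSeries_monomial_single (i : σ) (x : A) (k : ℕ) :
    MvPowerSeries.coeff (Finsupp.single i k)
        (expSeries (MvPowerSeries.monomial (Finsupp.single i 1) x)) =
      ((k.factorial : ℂ)⁻¹) • x ^ k := by
  classical
  change (∑ᶠ j : ℕ, _) = _
  rw [finsum_eq_single _ k]
  · rw [monomial_single_pow, MvPowerSeries.coeff_monomial_same]
  · intro j hj
    rw [monomial_single_pow, MvPowerSeries.coeff_monomial, if_neg, smul_zero]
    exact fun e => hj (Finsupp.single_injective i e).symm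

theorem coeff_expSeries_monomial_of_ne (i : σ) (x : A) {d : σ →₀ ℕ}
    (hd : ∀ k, d ≠ Finsupp.single i k) :
    MvPowerSeries.coeff d (expSeries (MvPowerSeries.monomial (Finsupp.single i 1) x)) = 0 := by
  classical
  change (∑ᶠ j : ℕ, _) = _
  rw [← finsum_zero (α := ℕ)]
  refine finsum_congr fun j => ?_
  rw [monomial_single_pow, MvPowerSeries.coeff_monomial, if_neg (hd j), smul_zero]

-- Each indeterminate occurs in exactly one factor, so only one splitting of the exponent `p`
-- contributes. A general list without repetitions is needed for the induction, hence the support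
-- condition.
open Classical in
theorem coeff_prod_expSeries (a : σ → A) {s : List σ} (hs : s.Nodup) (p : σ →₀ ℕ) :
    MvPowerSeries.coeff p
        (s.map fun i => expSeries (MvPowerSeries.monomial (Finsupp.single i 1) (a i))).prod =
      if ∀ i, p i ≠ 0 → i ∈ s then
        (s.map fun i => (((p i).factorial : ℂ)⁻¹) • a i ^ p i).prod else 0 := by
  induction s generalizing p with
  | nil =>
    rw [List.map_nil, List.prod_nil, MvPowerSeries.coeff_one]
    refine if_congr ?_ rfl rfl
    simp [Finsupp.ext_iff]
  | cons i s ih =>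
    obtain ⟨his, hs⟩ := List.nodup_cons.1 hs
    rw [List.map_cons, List.prod_cons, MvPowerSeries.coeff_mul,
      Finset.sum_eq_single (Finsupp.single i (p i), p.erase i)]
    · rw [coeff_expSeries_monomial_single, ih hs]
      have e : (∀ j, (p.erase i) j ≠ 0 → j ∈ s) ↔ ∀ j, p j ≠ 0 → j ∈ i :: s := by
        refine forall_congr' fun j => ?_
        by_cases hj : j = i
        · subst hj; simp
        · simp [Finsupp.erase_ne hj, hj]
      rw [if_congr e rfl rfl]
      split_ifs
      · rw [List.map_cons, List.prod_cons]
        congr 2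
        refine List.map_congr_left fun j hj => ?_
        have hji : j ≠ i := by
          rintro rfl
          exact his hj
        rw [Finsupp.erase_ne hji]
      · rw [mul_zero]
    · rintro ⟨q, r⟩ hqr hne
      rw [mem_antidiagonal] at hqr
      simp only at hqr ⊢
      by_cases hq : ∀ k, q ≠ Finsupp.single i k
      · rw [coeff_expSeries_monomial_of_ne i _ hq, zero_mul]
      · push Not at hq
        obtain ⟨k, rfl⟩ := hq
        rw [ih hs, if_neg, mul_zero]
        -- Since `i ∉ s`, the second exponent vanishes at `i`; the splitting is then the
        -- distinguished one.
        intro hr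
        have hri : r i = 0 := by
          by_contra h
          exact his (hr i h)
        refine hne (Prod.ext ?_ ?_)
        · simp [← hqr, hri]
        · ext j
          by_cases hj : j = i
          · subst hj; simp [hri]
          · simp [← hqr, Finsupp.erase_ne hj]
    · intro h
      exact absurd (mem_antidiagonal.2 (Finsupp.single_add_erase i p)) h

theorem prod_map_smul {ι : Type*} (c : ι → ℂ) (y : ι → A) (s : List ι) :
    (s.map fun i => c i • y i).prod = (s.map c).prod • (s.map y).prod := by
  induction s with
  | nil => simp
  | cons i s ih => simp only [List.map_cons, List.prod_cons, ih, smul_mul_smul_comm]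

/-- Subtracting 1 removes the constant term, just as `prodNonempty` vanishes on the empty word. -/
theorem coeff_prod_expSeries_sub_one {n : ℕ} (a : Fin n → A) (p : Fin n →₀ ℕ) :
    MvPowerSeries.coeff p ((List.ofFn fun i =>
        expSeries (MvPowerSeries.monomial (Finsupp.single i 1) (a i))).prod - 1) =
      ((∏ i, ((p i).factorial : ℂ))⁻¹) • prodNonempty (repeated a p) := by
  classical
  rw [List.ofFn_eq_map, map_sub, coeff_prod_expSeries a (List.nodup_finRange n),
    if_pos fun i _ => List.mem_finRange i, prod_map_smul, ← prod_repeated, ← Fin.prod_univ_def,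
    Finset.prod_inv_distrib, MvPowerSeries.coeff_one]
  by_cases h : p = 0
  · subst h
    simp [repeated_eq_nil_iff.2, prodNonempty_nil]
  · rw [if_neg h, sub_zero, prodNonempty_of_ne (mt repeated_eq_nil_iff.1 h)]

/-- Exponential generating series turn convolution into multiplication: the binomials from
unshuffling satisfy C(p,q)/p! = 1/(q! (p-q)!) in each coordinate. -/
theorem coeff_prod_expSeries_sub_one_pow {n : ℕ} (a : Fin n → A) (k : ℕ) (p : Fin n →₀ ℕ) :
    MvPowerSeries.coeff p (((List.ofFn fun i =>
        expSeries (MvPowerSeries.monomial (Finsupp.single i 1) (a i))).prod - 1) ^ k) =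
      ((∏ i, ((p i).factorial : ℂ))⁻¹) • convPow prodNonempty k (repeated a p) := by
  classical
  induction k generalizing p with
  | zero =>
    rw [pow_zero, MvPowerSeries.coeff_one]
    by_cases h : p = 0
    · subst h
      simp [repeated_eq_nil_iff.2, convPow]
    · simp only [convPow, if_neg h, if_neg (mt repeated_eq_nil_iff.1 h), smul_zero]
  | succ k ih =>
    rw [pow_succ, MvPowerSeries.coeff_mul, convPow_succ, unshuffleSum_repeated, Finset.smul_sum]
    refine Finset.sum_congr rfl fun x hx => ?_
    rw [ih, coeff_prod_expSeries_sub_one, smul_mul_smul_comm, ← Nat.cast_smul_eq_nsmul ℂ, smul_smul]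
    congr 1
    rw [← mul_inv, ← Finset.prod_mul_distrib, ← Finset.prod_inv_distrib, ← Finset.prod_inv_distrib,
      Nat.cast_prod, ← Finset.prod_mul_distrib]
    refine Finset.prod_congr rfl fun i _ => ?_
    have hi : x.1 i + x.2 i = p i := DFunLike.congr_fun (mem_antidiagonal.1 hx) i
    rw [← hi, ← Nat.add_choose_mul_factorial_mul_factorial, ← Nat.choose_symm_add]
    have h1 : ((x.1 i).factorial : ℂ) ≠ 0 := Nat.cast_ne_zero.2 (Nat.factorial_ne_zero _)
    have h2 : ((x.2 i).factorial : ℂ) ≠ 0 := Nat.cast_ne_zero.2 (Nat.factorial_ne_zero _)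
    have h3 : ((x.1 i + x.2 i).choose (x.1 i) : ℂ) ≠ 0 :=
      Nat.cast_ne_zero.2 (Nat.choose_pos (Nat.le_add_right _ _)).ne'
    push_cast
    field_simp

theorem coeff_logSeries_prod_expSeries {n : ℕ} (a : Fin n → A) (p : Fin n →₀ ℕ) :
    MvPowerSeries.coeff p (logSeries (List.ofFn fun i =>
        expSeries (MvPowerSeries.monomial (Finsupp.single i 1) (a i))).prod) =
      ((∏ i, ((p i).factorial : ℂ))⁻¹) • K A (repeated a p).get := by
  rw [K_eq_sum, List.ofFn_get]
  change (∑ᶠ k : ℕ, _) = _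
  simp only [coeff_prod_expSeries_sub_one_pow]
  rw [finsum_eq_sum_of_support_subset (s := Finset.range (repeated a p).length), Finset.smul_sum]
  · exact Finset.sum_congr rfl fun k _ => smul_comm _ _ _
  · intro k hk
    rw [Finset.coe_range, Set.mem_Iio]
    by_contra hlt
    refine hk ?_
    dsimp only
    rw [convPow_eq_zero prodNonempty_nil (by omega), smul_zero, smul_zero]

end CBH

end NCT

end

/-! ### Assembly of the four statements -/

theorem mainTheorem11 (A : Type*) [Ring A] [Algebra ℂ A] (L : Type*) :
    -- the cumulants are well defined
    (∀ (n : ℕ) (X : Fin n → A),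
      ∃! P : Polynomial A, (NCT.system A).IsDotPolynomial X P) ∧
    -- cumulants in terms of ordered set partitions
    (∀ (n : ℕ), 0 < n → ∀ X : Fin n → A,
      NCT.K A X = ∑ π : NCT.OP n,
        ((-1 : ℂ) ^ (π.1.length - 1) / (π.1.length : ℂ)) •
          (π.1.map (NCT.blockProd X)).prod) ∧
    -- the Campbell-Baker-Hausdorff formula
    (∀ (n : ℕ) (a : Fin n → A) (p : Fin n →₀ ℕ),
      MvPowerSeries.coeff p
        (NCT.logSeries (List.ofFn fun i =>
          NCT.expSeries (MvPowerSeries.monomial (Finsupp.single i 1) (a i))).prod) =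
        if p = 0 then 0
        else ((∏ i, ((p i).factorial : ℂ))⁻¹) • NCT.K A (NCT.repeated a p).get) ∧
    -- on the free algebra the cumulants of letters are values of the Lie projector
    (∀ (n : ℕ) (a : Fin n → L),
      (Function.support (NCT.lieTerm (List.ofFn fun k => NCT.letter (a k)).prod)).Finite ∧
      NCT.K (NCT.FreeAlg L) (fun k => NCT.letter (a k)) =
        NCT.lieProj (List.ofFn fun k => NCT.letter (a k)).prod) := by
  refine ⟨fun n X => ⟨_, NCT.isDotPolynomial_dotPolynomial X, fun Q hQ =>
    NCT.isDotPolynomial_unique hQ (NCT.isDotPolynomial_dotPolynomial X)⟩, ?_, ?_, ?_⟩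
  · intro n hn X
    rw [NCT.sum_OP hn fun π => ((-1 : ℂ) ^ (π.length - 1) / (π.length : ℂ)) •
      (π.map (NCT.blockProd X)).prod, NCT.K_eq_sum]
    refine Finset.sum_congr rfl fun k _ => ?_
    -- The word is the image under `X` of the sorted set of all positions, so convolution powers
    -- become sums over ordered partitions.
    rw [List.ofFn_eq_map, ← Fin.sort_univ, NCT.convPow_prodNonempty_sort, Finset.smul_sum]
    refine Finset.sum_congr rfl fun π hπ => ?_
    rw [(NCT.mem_orderedPartitions.1 hπ).1, Nat.add_sub_cancel, Nat.cast_succ]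
    rfl
  · intro n a p
    rw [NCT.coeff_logSeries_prod_expSeries]
    split_ifs with hp
    -- The constant term vanishes because the cumulant of the empty word is an empty sum.
    · have h : (NCT.repeated a p).length = 0 :=
        List.length_eq_zero_iff.2 (NCT.repeated_eq_nil_iff.2 hp)
      rw [NCT.K_eq_sum, Finset.range_eq_empty_iff.2 h, Finset.sum_empty, smul_zero]
    · rfl
  · intro n a
    refine ⟨?_, NCT.K_letter_eq_lieProj a⟩
    have e : (List.ofFn fun k => NCT.letter (a k)) = (List.ofFn a).map NCT.letter := by
      rw [List.map_ofFn]; rfl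
    rw [e]
    exact (Finset.finite_toSet _).subset (NCT.support_lieTerm_prod_letter _)
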